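/- Let $N\ge 1$ and let $\mathbb G=(\mathbb R^N,\circ)$ be a homogeneous group, i.e. a Lie group structure on $\mathbb R^N$ (for its standard smooth structure) for which there are $v_1,\dots,v_N>0$ such that every dilation $D_\lambda(x)=(\lambda^{v_1}x_1,\dots,\lambda^{v_N}x_N)$, $\lambda>0$, is a group automorphism. Let $dx$ be the Lebesgue measure (which is the Haar measure of $\mathbb G$), and let $|\cdot|:\mathbb G\to[0,\infty)$ be a quasi-norm, i.e. a continuous function with $|x^{-1}|=|x|$, $|D_\lambda x|=\lambda|x|$ for all $\lambda>0$, and $|x|=0\iff x=0$. Write $\mathbb B(0,r)=\{y\in\mathbb G:|y|<r\}$ and let $|\mathbb B(0,r)|$ denote its measure. Let $0<p\le q<\infty$, $a,b\in\mathbb R$ and $\epsilon>0$. For a constant $C>0$ consider the inequality $$\left(\int_{\mathbb G}\left[\exp\left(\epsilon\,|\mathbb B(0,|x|)|^{-\epsilon}\int_{\mathbb B(0,|x|)}|\mathbb B(0,|y|)|^{\epsilon-1}\log f(y)\,dy\right)\right]^q|\mathbb B(0,|x|)|^a\,dx\right)^{1/q}\le C\left(\int_{\mathbb G}f(x)^p\,|\mathbb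 B(0,|x|)|^b\,dx\right)^{1/p}\qquad(\ast)$$ where the inner integral is taken in $[-\infty,\infty]$ (positive part minus negative part, with $\infty-\infty:=-\infty$) and $\exp(-\infty)=0$, $\exp(\infty)=\infty$. Then there is a finite constant $C>0$ such that $(\ast)$ holds for all measurable $f:\mathbb G\to(0,\infty)$ if and only if $$p(a+1)-q(b+1)=0 .$$ In that case there is a least such constant $C$, and it satisfies $$\left(\frac pq\right)^{1/q}\epsilon^{\frac1p-\frac1q}\exp\left(\frac{b+1}{\epsilon p}-\frac1p\right)\le C\le\left(\frac pq\right)^{1/q}\epsilon^{\frac1p-\frac1q}\exp\left(\frac{b+1}{\epsilon p}\right).$$ -/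

import Mathlib

open MeasureTheory
open scoped ENNReal ContDiff

noncomputable section

/-- The anisotropic dilation `D_t(x) = (t^{v₁} x₁, …, t^{v_N} x_N)` of `ℝ^N` with weights `v`. -/
def anisotropicDilation {N : ℕ} (v : Fin N → ℝ) (t : ℝ) (x : EuclideanSpace ℝ (Fin N)) :
    EuclideanSpace ℝ (Fin N) :=
  WithLp.toLp 2 fun i => t ^ v i * x i

/-- A homogeneous (Lie) group: a group law on `ℝ^N` with smooth multiplication and
inversion (i.e. a Lie group with underlying manifold `ℝ^N`), together with positive weights `v₁, …, v_N` such that every dilation `D_t`,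
`t > 0`, is an automorphism of the group. (The group law is written multiplicatively; it is
unrelated to the vector addition of `ℝ^N`.) -/
structure HomogeneousGroup (N : ℕ) extends Group (EuclideanSpace ℝ (Fin N)) where
  contDiff_mul : ContDiff ℝ ∞
    fun z : EuclideanSpace ℝ (Fin N) × EuclideanSpace ℝ (Fin N) => z.1 * z.2
  contDiff_inv : ContDiff ℝ ∞ fun x : EuclideanSpace ℝ (Fin N) => x⁻¹
  weight : Fin N → ℝ
  weight_pos : ∀ i, 0 < weight i
  dilation_mul : ∀ t : ℝ, 0 < t → ∀ x y : EuclideanSpace ℝ (Fin N),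
    anisotropicDilation weight t (x * y) =
      anisotropicDilation weight t x * anisotropicDilation weight t y

/-- A quasi-norm on a homogeneous group: a continuous function `G → [0, ∞)` that is symmetric
under group inversion, homogeneous of degree one under the dilations and vanishes exactly at the
origin. -/
structure QuasiNorm {N : ℕ} (G : HomogeneousGroup N) where
  toFun : EuclideanSpace ℝ (Fin N) → ℝ
  continuous_toFun : Continuous toFun
  nonneg : ∀ x, 0 ≤ toFun x
  map_inv : ∀ x, toFun (G.inv x) = toFun x
  map_dilation : ∀ t : ℝ, 0 < t → ∀ x, toFun (anisotropicDilation G.weight t x) = t * toFun x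
  eq_zero_iff : ∀ x, toFun x = 0 ↔ x = 0

namespace QuasiNorm

variable {N : ℕ} {G : HomogeneousGroup N}

/-- The quasi-ball `𝔹(0, r) = {y : |y| < r}`. -/
def ball (ν : QuasiNorm G) (r : ℝ) : Set (EuclideanSpace ℝ (Fin N)) :=
  {y | ν.toFun y < r}

/-- The volume `|𝔹(0, |x|)|`. The Haar measure of a homogeneous group is the Lebesgue measure
of `ℝ^N`. -/
def ballVol (ν : QuasiNorm G) (x : EuclideanSpace ℝ (Fin N)) : ℝ :=
  volume.real (ν.ball (ν.toFun x))

end QuasiNorm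

/-- The Lebesgue integral of a real function over `s` with values in `[-∞, ∞]`: the integral of the
positive part minus the integral of the negative part. -/
def extIntegralOn {N : ℕ} (s : Set (EuclideanSpace ℝ (Fin N)))
    (g : EuclideanSpace ℝ (Fin N) → ℝ) : EReal :=
  ((∫⁻ y in s, ENNReal.ofReal (g y) : ℝ≥0∞) : EReal) -
    ((∫⁻ y in s, ENNReal.ofReal (-g y) : ℝ≥0∞) : EReal)

namespace QuasiNorm

variable {N : ℕ} {G : HomogeneousGroup N}

/-- The weighted geometric mean
`exp (ε |𝔹(0,|x|)|^{-ε} ∫_{𝔹(0,|x|)} |𝔹(0,|y|)|^{ε-1} log f(y) dy)`, with `exp (-∞) = 0`. -/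
def geomMean (ν : QuasiNorm G) (ε : ℝ) (f : EuclideanSpace ℝ (Fin N) → ℝ)
    (x : EuclideanSpace ℝ (Fin N)) : ℝ≥0∞ :=
  EReal.exp (((ε * ν.ballVol x ^ (-ε) : ℝ) : EReal) *
    extIntegralOn (ν.ball (ν.toFun x)) fun y => ν.ballVol y ^ (ε - 1) * Real.log (f y))

/-- The Levin–Cochran–Lee inequality with constant `C` and weights
`|𝔹(0,|x|)|^a`, `|𝔹(0,|x|)|^b` holds for all positive (measurable) functions on the group. -/
def LevinCochranLee (ν : QuasiNorm G) (p q a b ε C : ℝ) : Prop :=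
  ∀ f : EuclideanSpace ℝ (Fin N) → ℝ, Measurable f → (∀ x, 0 < f x) →
    (∫⁻ x, ν.geomMean ε f x ^ q * ENNReal.ofReal (ν.ballVol x ^ a)) ^ (1 / q) ≤
      ENNReal.ofReal C *
        (∫⁻ x, ENNReal.ofReal (f x) ^ p * ENNReal.ofReal (ν.ballVol x ^ b)) ^ (1 / p)

end QuasiNorm

end

/-!
The proof reduces everything to one real variable through the function `V x = |𝔹(0,|x|)|`.
Homogeneity gives `|𝔹(0,r)| = r ^ Q |𝔹(0,1)|` with `0 < |𝔹(0,1)| < ∞`, so the set `{V < s}` is a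
quasi-ball of volume `s`; hence quasi-balls are the sublevel sets of `V` and `V` pushes Lebesgue
measure on the group forward to Lebesgue measure on `(0, ∞)` (`QuasiNorm.map_ballVol`). Neither the
group law nor polar coordinates are needed beyond this.

*Upper bound.* The operator `geomMean` is the geometric mean for the probability measure
`ε V(x)^{-ε} V(y)^{ε-1} dy` on `{V(y) < V(x)}`, under which `log V` has mean `log V(x) - 1/ε`.
Jensen's inequality for `log (f^p V^{b+1})` gives
`geomMean(x)^p ≤ e^{(b+1)/ε} ε V(x)^{-(b+1)-ε} ∫_{V(y)<V(x)} V(y)^ε W(y) dy` with `W = f^p V^b`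
(`QuasiNorm.geomMean_rpow_le`). With `r = q / p ≥ 1`, the power mean inequality for the measure
`W dy`, of total mass `M`, bounds the `r`-th power of the integral by
`M^{r-1} ∫_{V(y)<V(x)} V(y)^{εr} W(y) dy`. Under `p(a+1) = q(b+1)` the remaining kernel is
`V(x)^{-1-εr} V(y)^{εr}`, whose integral in `x` is `1/(εr)` for every `y`; Tonelli finishes
(`QuasiNorm.levinCochranLee_upper`).

*Necessity and lower bound.* The inequality is tested on `V^k` cut off at `V = T`, with a small
integrable tail since `f` has to be positive (`QuasiNorm.LevinCochranLee.power_test`). For large `k`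
both sides are powers of `T`, and comparing `T → 0` with `T → ∞` forces `p(a+1) = q(b+1)`. The
choice `W = V^{ε-1}`, `T = 1` gives the lower bound for the constant.

The admissible constants are closed under limits in `(0, ∞)`, so the infimum is attained
(`QuasiNorm.exists_isLeast_levinCochranLee`).
-/

/-! ### Volumes of quasi-balls -/

/-- The dilation `D_t` as a linear endomorphism of `ℝ^N`. -/
noncomputable def dilationLinear {N : ℕ} (v : Fin N → ℝ) (t : ℝ) :
    EuclideanSpace ℝ (Fin N) →ₗ[ℝ] EuclideanSpace ℝ (Fin N) :=
  Matrix.toLpLin 2 2 (Matrix.diagonal fun i => t ^ v i)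

theorem dilationLinear_apply {N : ℕ} (v : Fin N → ℝ) (t : ℝ) (x : EuclideanSpace ℝ (Fin N)) :
    dilationLinear v t x = anisotropicDilation v t x := by
  ext i
  simp [dilationLinear, anisotropicDilation, Matrix.toLpLin_apply, Matrix.mulVec_diagonal]

theorem det_dilationLinear {N : ℕ} (v : Fin N → ℝ) {t : ℝ} (ht : 0 < t) :
    LinearMap.det (dilationLinear v t) = t ^ ∑ i, v i := by
  have h : dilationLinear v t = Matrix.toLin (PiLp.basisFun 2 ℝ (Fin N))
      (PiLp.basisFun 2 ℝ (Fin N)) (Matrix.diagonal fun i => t ^ v i) := by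
    rw [dilationLinear, Matrix.toLpLin_eq_toLin]
  rw [h, LinearMap.det_toLin, Matrix.det_diagonal, Real.rpow_sum_of_pos ht]

theorem isBounded_of_coord_le {N : ℕ} {S : Set (EuclideanSpace ℝ (Fin N))} (R : ℝ)
    (h : ∀ x ∈ S, ∀ i, |x i| ≤ R) : Bornology.IsBounded S := by
  rw [isBounded_iff_forall_norm_le]
  refine ⟨Real.sqrt (∑ _i : Fin N, R ^ 2), fun x hx => ?_⟩
  rw [EuclideanSpace.norm_eq]
  refine Real.sqrt_le_sqrt (Finset.sum_le_sum fun i _ => ?_)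
  rw [Real.norm_eq_abs]
  exact pow_le_pow_left₀ (abs_nonneg _) (h x hx i) 2

namespace QuasiNorm

variable {N : ℕ} {G : HomogeneousGroup N}

theorem mem_ball (ν : QuasiNorm G) {r : ℝ} {y : EuclideanSpace ℝ (Fin N)} :
    y ∈ ν.ball r ↔ ν.toFun y < r := Iff.rfl

theorem isOpen_ball (ν : QuasiNorm G) (r : ℝ) : IsOpen (ν.ball r) :=
  isOpen_lt ν.continuous_toFun continuous_const

theorem preimage_dilation_ball (ν : QuasiNorm G) {r : ℝ} (hr : 0 < r) :
    dilationLinear G.weight r ⁻¹' ν.ball r = ν.ball 1 := by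
  ext x
  simp only [Set.mem_preimage, dilationLinear_apply, mem_ball,
    ν.map_dilation r hr]
  exact ⟨fun h => by nlinarith, fun h => by nlinarith⟩

theorem volume_ball (ν : QuasiNorm G) {r : ℝ} (hr : 0 < r) :
    volume (ν.ball r) = ENNReal.ofReal (r ^ ∑ i, G.weight i) * volume (ν.ball 1) := by
  have hpos : 0 < r ^ ∑ i, G.weight i := Real.rpow_pos_of_pos hr _
  have hdet := det_dilationLinear G.weight hr
  rw [← ν.preimage_dilation_ball hr,
    Measure.addHaar_preimage_linearMap _ (by rw [hdet]; exact hpos.ne'), hdet, ← mul_assoc,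
    ← ENNReal.ofReal_mul hpos.le, abs_of_pos (inv_pos.2 hpos), mul_inv_cancel₀ hpos.ne']
  simp

/-- The gauge `g x = ∑ |xᵢ|^{1/vᵢ}` is homogeneous of degree one, and `{g = 1}` is a compact set
without the origin, so `ν ≥ m > 0` there. By homogeneity `g x ≤ ν x / m` everywhere, which bounds
the coordinates of the points of the unit quasi-ball. -/
theorem exists_coord_bound (ν : QuasiNorm G) :
    ∃ R : ℝ, ∀ x ∈ ν.ball 1, ∀ i, |x i| ≤ R := by
  have hv := G.weight_pos
  set v := G.weight with hvdef
  set g : EuclideanSpace ℝ (Fin N) → ℝ := fun x => ∑ i, |x i| ^ (1 / v i) with hg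
  have hterm : ∀ x i, |x i| ^ (1 / v i) ≤ g x := fun x i =>
    Finset.single_le_sum (f := fun i => |x i| ^ (1 / v i))
      (fun j _ => Real.rpow_nonneg (abs_nonneg _) _) (Finset.mem_univ i)
  have hcoord : ∀ x i, |x i| ≤ g x ^ v i := fun x i => by
    have h := Real.rpow_le_rpow (Real.rpow_nonneg (abs_nonneg _) _) (hterm x i) (hv i).le
    rwa [← Real.rpow_mul (abs_nonneg _), one_div_mul_cancel (hv i).ne', Real.rpow_one] at h
  have hgcont : Continuous g := continuous_finsetSum _ fun i _ =>
    Continuous.rpow_const (by fun_prop) fun _ => Or.inr (one_div_pos.2 (hv i)).le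
  have hK : IsCompact {x | g x = 1} := by
    refine Metric.isCompact_of_isClosed_isBounded (isClosed_eq hgcont continuous_const) ?_
    refine isBounded_of_coord_le 1 fun x hx i => ?_
    have h := hcoord x i
    rwa [show g x = 1 from hx, Real.one_rpow] at h
  obtain ⟨m, hm, hmin⟩ := hK.exists_forall_le' ν.continuous_toFun.continuousOn (a := 0)
    fun x hx => by
      refine (ν.nonneg x).lt_of_ne' fun h => ?_
      rw [ν.eq_zero_iff] at h
      subst h
      have h0 : g 0 = 1 := hx
      simp [hg, Real.zero_rpow (inv_pos.2 (hv _)).ne'] at h0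
  refine ⟨∑ i, (1 / m) ^ v i, fun x hx i => ?_⟩
  have hgx0 : 0 ≤ g x := Finset.sum_nonneg fun i _ => Real.rpow_nonneg (abs_nonneg _) _
  have hgx : g x ≤ 1 / m := by
    rcases hgx0.eq_or_lt with h | h
    · rw [← h]; positivity
    have hinv : 0 < (g x)⁻¹ := inv_pos.2 h
    have hone : g (anisotropicDilation v (g x)⁻¹ x) = 1 := by
      have : ∀ i, |(anisotropicDilation v (g x)⁻¹ x) i| ^ (1 / v i) =
          (g x)⁻¹ * |x i| ^ (1 / v i) := fun i => by
        rw [anisotropicDilation, abs_mul, Real.mul_rpow (abs_nonneg _) (abs_nonneg _),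
          abs_of_nonneg (Real.rpow_nonneg hinv.le _), ← Real.rpow_mul hinv.le,
          mul_one_div_cancel (hv i).ne', Real.rpow_one]
      calc g (anisotropicDilation v (g x)⁻¹ x) = ∑ i, (g x)⁻¹ * |x i| ^ (1 / v i) :=
            Finset.sum_congr rfl fun i _ => this i
        _ = (g x)⁻¹ * g x := by rw [← Finset.mul_sum]
        _ = 1 := inv_mul_cancel₀ h.ne'
    have h1 := hmin _ hone
    rw [ν.map_dilation _ hinv, inv_mul_eq_div, le_div_iff₀ h] at h1
    rw [le_div_iff₀ hm]
    have h2 : ν.toFun x < 1 := hx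
    linarith [mul_comm m (g x)]
  refine ((hcoord x i).trans (Real.rpow_le_rpow hgx0 hgx (hv i).le)).trans ?_
  exact Finset.single_le_sum (f := fun i => (1 / m) ^ v i)
    (fun j _ => Real.rpow_nonneg (by positivity) _) (Finset.mem_univ i)

theorem volume_ball_one_lt_top (ν : QuasiNorm G) : volume (ν.ball 1) < ⊤ := by
  obtain ⟨R, hR⟩ := ν.exists_coord_bound
  exact (isBounded_of_coord_le R hR).measure_lt_top

theorem toFun_zero (ν : QuasiNorm G) : ν.toFun 0 = 0 := (ν.eq_zero_iff 0).2 rfl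

theorem volume_ball_one_pos (ν : QuasiNorm G) : 0 < volume (ν.ball 1) :=
  (ν.isOpen_ball 1).measure_pos _ ⟨0, by simp [ball, ν.toFun_zero]⟩

theorem volumeReal_ball_one_pos (ν : QuasiNorm G) : 0 < volume.real (ν.ball 1) :=
  ENNReal.toReal_pos ν.volume_ball_one_pos.ne' ν.volume_ball_one_lt_top.ne

end QuasiNorm

namespace HomogeneousGroup

/-- The homogeneous dimension is positive because `N > 0`. -/
theorem sum_weight_pos {N : ℕ} (hN : 0 < N) (G : HomogeneousGroup N) : 0 < ∑ i, G.weight i :=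
  haveI : Nonempty (Fin N) := ⟨⟨0, hN⟩⟩
  Finset.sum_pos (fun i _ => G.weight_pos i) Finset.univ_nonempty

end HomogeneousGroup

namespace QuasiNorm

variable {N : ℕ} {G : HomogeneousGroup N}

theorem ballVol_eq (hN : 0 < N) (ν : QuasiNorm G) (x : EuclideanSpace ℝ (Fin N)) :
    ν.ballVol x = ν.toFun x ^ (∑ i, G.weight i) * volume.real (ν.ball 1) := by
  rcases (ν.nonneg x).eq_or_lt with h | h
  · have : ν.ball (ν.toFun x) = ∅ := by
      ext y
      simp [ball, ← h, ν.nonneg y]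
    rw [ballVol, this, ← h, Real.zero_rpow (G.sum_weight_pos hN).ne']
    simp
  · rw [ballVol, Measure.real, ν.volume_ball h, ENNReal.toReal_mul,
      ENNReal.toReal_ofReal (Real.rpow_nonneg h.le _), Measure.real]

theorem ballVol_nonneg (ν : QuasiNorm G) (x : EuclideanSpace ℝ (Fin N)) : 0 ≤ ν.ballVol x :=
  ENNReal.toReal_nonneg

theorem continuous_ballVol (hN : 0 < N) (ν : QuasiNorm G) : Continuous ν.ballVol := by
  rw [funext (ν.ballVol_eq hN)]
  exact (ν.continuous_toFun.rpow_const fun _ => Or.inr (G.sum_weight_pos hN).le).mul_const _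

theorem measurable_ballVol (hN : 0 < N) (ν : QuasiNorm G) : Measurable ν.ballVol :=
  (ν.continuous_ballVol hN).measurable

/-- Quasi-balls are the sublevel sets of the volume function. -/
theorem ball_toFun_eq (hN : 0 < N) (ν : QuasiNorm G) (x : EuclideanSpace ℝ (Fin N)) :
    ν.ball (ν.toFun x) = {y | ν.ballVol y < ν.ballVol x} := by
  ext y
  simp only [mem_ball, Set.mem_ofPred_eq, ν.ballVol_eq hN]
  rw [mul_lt_mul_iff_left₀ ν.volumeReal_ball_one_pos,
    Real.rpow_lt_rpow_iff (ν.nonneg y) (ν.nonneg x) (G.sum_weight_pos hN)]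

theorem volume_ballVol_lt (hN : 0 < N) (ν : QuasiNorm G) (s : ℝ) :
    volume {x | ν.ballVol x < s} = ENNReal.ofReal s := by
  rcases le_or_gt s 0 with hs | hs
  · rw [ENNReal.ofReal_of_nonpos hs]
    convert measure_empty (μ := (volume : Measure (EuclideanSpace ℝ (Fin N))))
    ext x
    simpa using hs.trans (ν.ballVol_nonneg x)
  · have hc := ν.volumeReal_ball_one_pos
    have hQ := G.sum_weight_pos hN
    set c := volume.real (ν.ball 1) with hcdef
    set Q := ∑ i, G.weight i with hQdef
    -- the radius of the quasi-ball of volume `s`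
    set r := (s / c) ^ (1 / Q) with hr
    have hsc : 0 < s / c := div_pos hs hc
    have hr0 : 0 < r := Real.rpow_pos_of_pos hsc _
    have hrQ : r ^ Q = s / c := by
      rw [hr, ← Real.rpow_mul hsc.le, one_div_mul_cancel hQ.ne', Real.rpow_one]
    have hset : {x | ν.ballVol x < s} = ν.ball r := by
      ext x
      simp only [mem_ball, Set.mem_ofPred_eq, ν.ballVol_eq hN]
      rw [← lt_div_iff₀ hc, ← hrQ, Real.rpow_lt_rpow_iff (ν.nonneg x) hr0.le hQ]
    rw [hset, ν.volume_ball hr0, ← hQdef, hrQ,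
      ← ENNReal.ofReal_toReal ν.volume_ball_one_lt_top.ne, ← Measure.real, ← hcdef,
      ← ENNReal.ofReal_mul hsc.le, div_mul_cancel₀ _ hc.ne']

/-- The volume function pushes Lebesgue measure on the group forward to Lebesgue measure on
`(0, ∞)`. This replaces polar coordinates: all integrals of functions of `|𝔹(0,|x|)|` become
one-dimensional. -/
theorem map_ballVol (hN : 0 < N) (ν : QuasiNorm G) :
    (volume : Measure (EuclideanSpace ℝ (Fin N))).map ν.ballVol =
      (volume : Measure ℝ).restrict (Set.Ioi 0) := by
  have hlt : ∀ s : ℝ, (volume : Measure (EuclideanSpace ℝ (Fin N))).map ν.ballVol (Set.Iio s) =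
      ENNReal.ofReal s := fun s => by
    rw [Measure.map_apply (ν.measurable_ballVol hN) measurableSet_Iio]
    exact ν.volume_ballVol_lt hN s
  refine Measure.ext_of_generateFrom_of_iUnion (Set.range Set.Iio) (fun n : ℕ => Set.Iio (n : ℝ))
    ?_ isPiSystem_Iio ?_ (fun n => ⟨_, rfl⟩) (fun n => by rw [hlt]; exact ENNReal.ofReal_ne_top) ?_
  · rw [← borel_eq_generateFrom_Iio, BorelSpace.measurable_eq (α := ℝ)]
  · ext x
    simpa using exists_nat_gt x
  · rintro _ ⟨s, rfl⟩
    rw [hlt, Measure.restrict_apply measurableSet_Iio, Set.inter_comm, Set.Ioi_inter_Iio,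
      Real.volume_Ioo, sub_zero]

theorem ae_ballVol_pos (hN : 0 < N) (ν : QuasiNorm G) :
    ∀ᵐ x : EuclideanSpace ℝ (Fin N), 0 < ν.ballVol x := by
  have h : ∀ᵐ t ∂(volume : Measure (EuclideanSpace ℝ (Fin N))).map ν.ballVol, 0 < t := by
    rw [ν.map_ballVol hN]
    exact ae_restrict_mem measurableSet_Ioi
  exact ae_of_ae_map (ν.measurable_ballVol hN).aemeasurable h

end QuasiNorm

/-! ### One-dimensional integrals -/

theorem lintegral_Ioo_rpow {α t : ℝ} (hα : 0 < α) (ht : 0 < t) :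
    ∫⁻ s in Set.Ioo 0 t, ENNReal.ofReal (s ^ (α - 1)) = ENNReal.ofReal (t ^ α / α) := by
  have hint : IntegrableOn (fun s : ℝ => s ^ (α - 1)) (Set.Ioc 0 t) :=
    (intervalIntegrable_iff_integrableOn_Ioc_of_le ht.le).1
      (intervalIntegral.intervalIntegrable_rpow' (by linarith))
  rw [restrict_Ioo_eq_restrict_Ioc, ← ofReal_integral_eq_lintegral_ofReal hint
    ((ae_restrict_mem measurableSet_Ioc).mono fun s hs => Real.rpow_nonneg hs.1.le _),
    ← intervalIntegral.integral_of_le ht.le, integral_rpow (Or.inl (by linarith)),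
    sub_add_cancel, Real.zero_rpow hα.ne', sub_zero]

theorem lintegral_Ioi_rpow {β s : ℝ} (hβ : 0 < β) (hs : 0 < s) :
    ∫⁻ t in Set.Ioi s, ENNReal.ofReal (t ^ (-1 - β)) = ENNReal.ofReal (s ^ (-β) / β) := by
  rw [← ofReal_integral_eq_lintegral_ofReal (integrableOn_Ioi_rpow_of_lt (by linarith) hs)
    ((ae_restrict_mem measurableSet_Ioi).mono fun t ht => Real.rpow_nonneg (hs.trans ht).le _),
    integral_Ioi_rpow_of_lt (by linarith) hs]
  congr 1
  rw [show -1 - β + 1 = -β by ring, neg_div_neg_eq]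

/-- The normalization `log (s / t) ≤ 0` makes the integrand of one sign, so integrability comes
from the antiderivative `s ^ ε log (s / t) / ε - s ^ ε / ε ^ 2`, which is continuous on `[0, t]`. -/
theorem rpow_mul_log_div_integral {ε t : ℝ} (hε : 0 < ε) (ht : 0 < t) :
    IntegrableOn (fun s : ℝ => s ^ (ε - 1) * Real.log (s / t)) (Set.Ioc 0 t) ∧
      ∫ s in 0..t, s ^ (ε - 1) * Real.log (s / t) = -(t ^ ε / ε ^ 2) := by
  set F : ℝ → ℝ := fun s => s ^ ε * Real.log (s / t) / ε - s ^ ε / ε ^ 2 with hF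
  have hderiv : ∀ s ∈ Set.Ioo 0 t, HasDerivAt F (s ^ (ε - 1) * Real.log (s / t)) s := by
    intro s hs
    have hs0 : s ≠ 0 := hs.1.ne'
    have h1 := Real.hasDerivAt_rpow_const (p := ε) (Or.inl hs0)
    have h2 := (((hasDerivAt_id s).div_const t).log (div_ne_zero hs0 ht.ne'))
    have h3 := ((h1.mul h2).div_const ε).sub (h1.div_const (ε ^ 2))
    refine HasDerivAt.congr_deriv (f := F) h3 ?_
    have h4 : s ^ ε = s ^ (ε - 1) * s := by
      rw [← Real.rpow_add_one hs0, sub_add_cancel]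
    simp only [id]
    rw [h4]
    field_simp
    ring
  have hpow : Continuous fun s : ℝ => s ^ ε :=
    continuous_id.rpow_const fun _ => Or.inr hε.le
  have hcont : ContinuousOn F (Set.Icc 0 t) := by
    refine ContinuousOn.sub (ContinuousOn.div_const ?_ _) (hpow.continuousOn.div_const _)
    intro s hs
    rcases hs.1.eq_or_lt with h | h
    · subst h
      have h1 := tendsto_log_mul_rpow_nhdsGT_zero hε
      have h2 : Filter.Tendsto (fun s : ℝ => s ^ ε * Real.log t) (nhdsWithin 0 (Set.Ioi 0))
          (nhds 0) := by
        have := (hpow.tendsto 0).mul_const (Real.log t)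
        rw [Real.zero_rpow hε.ne', zero_mul] at this
        exact this.mono_left nhdsWithin_le_nhds
      have h3 : Filter.Tendsto (fun s : ℝ => s ^ ε * Real.log (s / t))
          (nhdsWithin 0 (Set.Ioi 0)) (nhds 0) := by
        have := h1.sub h2
        rw [sub_zero] at this
        refine this.congr' ?_
        filter_upwards [self_mem_nhdsWithin] with s hs
        rw [Real.log_div (ne_of_gt hs) ht.ne']
        ring
      have h4 : ContinuousWithinAt (fun s : ℝ => s ^ ε * Real.log (s / t)) (Set.Ioi 0) 0 := by
        rw [ContinuousWithinAt]
        simpa [Real.zero_rpow hε.ne'] using h3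
      exact (continuousWithinAt_Ioi_iff_Ici.1 h4).mono fun s hs => hs.1
    · exact (hpow.continuousAt.mul
        ((continuousAt_id.div_const t).log (div_pos h ht).ne')).continuousWithinAt
  have hint : IntegrableOn (fun s : ℝ => s ^ (ε - 1) * Real.log (s / t)) (Set.Ioc 0 t) := by
    have := intervalIntegral.integrableOn_deriv_of_nonneg hcont.neg
      (fun s hs => (hderiv s hs).neg) fun s hs => by
        have h1 : Real.log (s / t) ≤ 0 :=
          Real.log_nonpos (div_pos hs.1 ht).le ((div_le_one ht).2 hs.2.le)
        have h2 := Real.rpow_nonneg hs.1.le (ε - 1)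
        nlinarith
    simpa using this.neg
  refine ⟨hint, ?_⟩
  rw [intervalIntegral.integral_eq_sub_of_hasDerivAt_of_le ht.le hcont hderiv
    ((intervalIntegrable_iff_integrableOn_Ioc_of_le ht.le).2 hint)]
  simp [hF, Real.zero_rpow hε.ne', div_self ht.ne']

theorem integrableOn_Ioo_rpow_mul_log {ε t : ℝ} (hε : 0 < ε) (ht : 0 < t) :
    IntegrableOn (fun s : ℝ => s ^ (ε - 1) * Real.log s) (Set.Ioo 0 t) ∧
      ∫ s in Set.Ioo 0 t, s ^ (ε - 1) * Real.log s = t ^ ε / ε * (Real.log t - 1 / ε) := by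
  obtain ⟨h1, h2⟩ := rpow_mul_log_div_integral hε ht
  have h3 : IntegrableOn (fun s : ℝ => s ^ (ε - 1)) (Set.Ioc 0 t) :=
    (intervalIntegrable_iff_integrableOn_Ioc_of_le ht.le).1
      (intervalIntegral.intervalIntegrable_rpow' (by linarith))
  have heq : Set.EqOn (fun s : ℝ => s ^ (ε - 1) * Real.log (s / t) + s ^ (ε - 1) * Real.log t)
      (fun s => s ^ (ε - 1) * Real.log s) (Set.Ioc 0 t) := fun s hs => by
    simp only [Real.log_div hs.1.ne' ht.ne']
    ring
  rw [intervalIntegral.integral_of_le ht.le] at h2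
  have h4 : ∫ s in Set.Ioc 0 t, s ^ (ε - 1) = t ^ ε / ε := by
    rw [← intervalIntegral.integral_of_le ht.le, integral_rpow (Or.inl (by linarith)),
      sub_add_cancel, Real.zero_rpow hε.ne', sub_zero]
  refine ⟨((h1.add (h3.mul_const _)).congr_fun heq measurableSet_Ioc).mono_set
    Set.Ioo_subset_Ioc_self, ?_⟩
  rw [restrict_Ioo_eq_restrict_Ioc, ← setIntegral_congr_fun measurableSet_Ioc heq,
    integral_add h1 (h3.mul_const _), h2, integral_mul_const, h4]
  field_simp
  ring

/-! ### Integrals of functions of the volume of a quasi-ball -/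

namespace QuasiNorm

variable {N : ℕ} {G : HomogeneousGroup N}

theorem map_restrict_ballVol (hN : 0 < N) (ν : QuasiNorm G) {S : Set ℝ} (hS : MeasurableSet S) :
    ((volume : Measure (EuclideanSpace ℝ (Fin N))).restrict (ν.ballVol ⁻¹' S)).map ν.ballVol =
      (volume : Measure ℝ).restrict (S ∩ Set.Ioi 0) := by
  rw [← Measure.restrict_map (ν.measurable_ballVol hN) hS, ν.map_ballVol hN,
    Measure.restrict_restrict hS]

theorem setLIntegral_comp_ballVol (hN : 0 < N) (ν : QuasiNorm G) {S : Set ℝ}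
    (hS : MeasurableSet S) {φ : ℝ → ℝ≥0∞} (hφ : Measurable φ) :
    ∫⁻ x in ν.ballVol ⁻¹' S, φ (ν.ballVol x) = ∫⁻ t in S ∩ Set.Ioi 0, φ t := by
  rw [← ν.map_restrict_ballVol hN hS, lintegral_map hφ (ν.measurable_ballVol hN)]

theorem lintegral_ballVol_rpow_lt (hN : 0 < N) (ν : QuasiNorm G) {α t : ℝ} (hα : 0 < α)
    (ht : 0 < t) :
    ∫⁻ x in ν.ballVol ⁻¹' Set.Iio t, ENNReal.ofReal (ν.ballVol x ^ (α - 1)) =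
      ENNReal.ofReal (t ^ α / α) := by
  rw [ν.setLIntegral_comp_ballVol hN measurableSet_Iio
    (φ := fun s => ENNReal.ofReal (s ^ (α - 1))) (by fun_prop), Set.inter_comm,
    Set.Ioi_inter_Iio, lintegral_Ioo_rpow hα ht]

theorem lintegral_ballVol_rpow_gt (hN : 0 < N) (ν : QuasiNorm G) {β s : ℝ} (hβ : 0 < β)
    (hs : 0 < s) :
    ∫⁻ x in ν.ballVol ⁻¹' Set.Ioi s, ENNReal.ofReal (ν.ballVol x ^ (-1 - β)) =
      ENNReal.ofReal (s ^ (-β) / β) := by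
  rw [ν.setLIntegral_comp_ballVol hN measurableSet_Ioi
    (φ := fun s => ENNReal.ofReal (s ^ (-1 - β))) (by fun_prop), Set.Ioi_inter_Ioi,
    sup_eq_left.2 hs.le, lintegral_Ioi_rpow hβ hs]

theorem integrableOn_ballVol_rpow_mul_log (hN : 0 < N) (ν : QuasiNorm G) {ε t : ℝ} (hε : 0 < ε)
    (ht : 0 < t) :
    IntegrableOn (fun x => ν.ballVol x ^ (ε - 1) * Real.log (ν.ballVol x))
      (ν.ballVol ⁻¹' Set.Iio t) := by
  have h := (integrableOn_Ioo_rpow_mul_log hε ht).1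
  rw [← Set.Ioi_inter_Iio, Set.inter_comm, IntegrableOn,
    ← ν.map_restrict_ballVol hN measurableSet_Iio] at h
  exact h.comp_measurable (ν.measurable_ballVol hN)

theorem integral_ballVol_rpow_mul_log (hN : 0 < N) (ν : QuasiNorm G) {ε t : ℝ} (hε : 0 < ε)
    (ht : 0 < t) :
    ∫ x in ν.ballVol ⁻¹' Set.Iio t, ν.ballVol x ^ (ε - 1) * Real.log (ν.ballVol x) =
      t ^ ε / ε * (Real.log t - 1 / ε) := by
  rw [← (integrableOn_Ioo_rpow_mul_log hε ht).2, ← Set.Ioi_inter_Iio, Set.inter_comm,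
    ← ν.map_restrict_ballVol hN measurableSet_Iio,
    integral_map (ν.measurable_ballVol hN).aemeasurable
      (by fun_prop : Measurable fun s : ℝ => s ^ (ε - 1) * Real.log s).aestronglyMeasurable]

end QuasiNorm

/-! ### Jensen's inequality for the extended geometric mean -/

theorem lintegral_ofReal_exp_ge {X : Type*} [MeasurableSpace X] {P : Measure X}
    [IsProbabilityMeasure P] {χ : X → ℝ} (hχ : Integrable χ P) :
    ENNReal.ofReal (Real.exp (∫ x, χ x ∂P)) ≤ ∫⁻ x, ENNReal.ofReal (Real.exp (χ x)) ∂P := by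
  set m := ∫ x, χ x ∂P with hm
  -- the tangent line of `exp` at the mean
  have h1 : ∫ x, Real.exp m * (1 + (χ x - m)) ∂P = Real.exp m := by
    have h2 : Integrable (fun x => χ x - m) P := hχ.sub (integrable_const _)
    rw [integral_const_mul, integral_add (integrable_const _) h2,
      integral_sub hχ (integrable_const _)]
    simp [← hm]
  calc ENNReal.ofReal (Real.exp m)
      = ENNReal.ofReal (∫ x, Real.exp m * (1 + (χ x - m)) ∂P) := by rw [h1]
    _ ≤ ∫⁻ x, ENNReal.ofReal (Real.exp m * (1 + (χ x - m))) ∂P := by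
        have hint : Integrable (fun x => Real.exp m * (1 + (χ x - m))) P :=
          ((integrable_const _).add (hχ.sub (integrable_const _))).const_mul _
        rw [integral_eq_lintegral_pos_part_sub_lintegral_neg_part hint]
        refine (ENNReal.ofReal_le_ofReal (sub_le_self _ ENNReal.toReal_nonneg)).trans ?_
        exact ENNReal.ofReal_toReal_le
    _ ≤ ∫⁻ x, ENNReal.ofReal (Real.exp (χ x)) ∂P := by
        refine lintegral_mono fun x => ENNReal.ofReal_le_ofReal ?_
        have h2 := Real.add_one_le_exp (χ x - m)
        calc Real.exp m * (1 + (χ x - m)) ≤ Real.exp m * Real.exp (χ x - m) :=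
              mul_le_mul_of_nonneg_left (by linarith) (Real.exp_pos m).le
          _ = Real.exp (χ x) := by rw [← Real.exp_add]; congr 1; ring

theorem lintegral_sub_lintegral_eq_integral {X : Type*} [MeasurableSpace X] {P : Measure X}
    {φ : X → ℝ} (hφ : Integrable φ P) :
    ((∫⁻ x, ENNReal.ofReal (φ x) ∂P : ℝ≥0∞) : EReal) -
      ((∫⁻ x, ENNReal.ofReal (-φ x) ∂P : ℝ≥0∞) : EReal) = ((∫ x, φ x ∂P : ℝ) : EReal) := by
  have h1 : ∫⁻ x, ENNReal.ofReal (φ x) ∂P ≠ ⊤ := hφ.lintegral_lt_top.ne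
  have h2 : ∫⁻ x, ENNReal.ofReal (-φ x) ∂P ≠ ⊤ := (Integrable.lintegral_lt_top (f := fun x => -φ x) hφ.neg).ne
  rw [integral_eq_lintegral_pos_part_sub_lintegral_neg_part hφ, EReal.coe_sub,
    EReal.coe_ennreal_toReal h1, EReal.coe_ennreal_toReal h2]

/-- Jensen's inequality `exp (∫ φ) ^ p ≤ exp (-∫ ψ) ∫ exp (p φ + ψ)`, where `∫ φ` is the extended
integral and `ψ` a compensating integrable function. When the positive part of `φ` alone has
infinite integral, so has `exp (p φ + ψ)`, because `exp` dominates the identity. -/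
theorem exp_extIntegral_rpow_le {X : Type*} [MeasurableSpace X] {P : Measure X}
    [IsProbabilityMeasure P] {φ ψ : X → ℝ} (hφ : Measurable φ) (hψ : Integrable ψ P) {p : ℝ}
    (hp : 0 < p) :
    EReal.exp (((∫⁻ x, ENNReal.ofReal (φ x) ∂P : ℝ≥0∞) : EReal) -
      ((∫⁻ x, ENNReal.ofReal (-φ x) ∂P : ℝ≥0∞) : EReal)) ^ p ≤
    ENNReal.ofReal (Real.exp (-∫ x, ψ x ∂P)) *
      ∫⁻ x, ENNReal.ofReal (Real.exp (p * φ x + ψ x)) ∂P := by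
  by_cases hneg : ∫⁻ x, ENNReal.ofReal (-φ x) ∂P = ⊤
  · rw [hneg, EReal.coe_ennreal_top, EReal.sub_top, EReal.exp_bot, ENNReal.zero_rpow_of_pos hp]
    exact zero_le
  by_cases hpos : ∫⁻ x, ENNReal.ofReal (φ x) ∂P = ⊤
  · have h1 : ∫⁻ x, ENNReal.ofReal (p * φ x) ∂P = ⊤ := by
      simp_rw [ENNReal.ofReal_mul hp.le]
      rw [lintegral_const_mul _ (by fun_prop), hpos,
        ENNReal.mul_top (by simpa using hp)]
    have hψneg : Integrable (fun x => -ψ x) P := hψ.neg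
    have h2 : ∫⁻ x, ENNReal.ofReal (p * φ x) ∂P ≤
        ∫⁻ x, ENNReal.ofReal (Real.exp (p * φ x + ψ x)) ∂P +
          ∫⁻ x, ENNReal.ofReal (-ψ x) ∂P := by
      rw [← lintegral_add_right' _ hψneg.aemeasurable.ennreal_ofReal]
      refine lintegral_mono fun x => ?_
      refine le_trans (ENNReal.ofReal_le_ofReal ?_) ENNReal.ofReal_add_le
      linarith [Real.add_one_le_exp (p * φ x + ψ x)]
    rw [h1, top_le_iff, ENNReal.add_eq_top,
      or_iff_left hψneg.lintegral_lt_top.ne] at h2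
    rw [h2, ENNReal.mul_top (by simpa using Real.exp_pos _)]
    exact le_top
  have hint : Integrable φ P := by
    refine ⟨hφ.aestronglyMeasurable, ?_⟩
    rw [hasFiniteIntegral_iff_enorm]
    have h1 : ∀ x, ‖φ x‖ₑ = ENNReal.ofReal (φ x) + ENNReal.ofReal (-φ x) := fun x => by
      rw [Real.enorm_eq_ofReal_abs]
      rcases le_total 0 (φ x) with h | h
      · rw [abs_of_nonneg h, ENNReal.ofReal_of_nonpos (p := -φ x) (by linarith), add_zero]
      · rw [abs_of_nonpos h, ENNReal.ofReal_of_nonpos (p := φ x) h, zero_add]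
    simp_rw [h1]
    rw [lintegral_add_left (by fun_prop)]
    exact ENNReal.add_lt_top.2 ⟨lt_top_iff_ne_top.2 hpos, lt_top_iff_ne_top.2 hneg⟩
  have h := lintegral_ofReal_exp_ge ((hint.const_mul p).add hψ)
  have h3 : ∫ x, ((fun x => p * φ x) + ψ) x ∂P = p * (∫ x, φ x ∂P) + ∫ x, ψ x ∂P := by
    rw [← integral_const_mul]
    exact integral_add (hint.const_mul p) hψ
  rw [h3] at h
  rw [lintegral_sub_lintegral_eq_integral hint, EReal.exp_coe,
    ENNReal.ofReal_rpow_of_pos (Real.exp_pos _), ← Real.exp_mul]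
  refine le_trans (le_of_eq ?_) (mul_le_mul_right h _)
  rw [← ENNReal.ofReal_mul (Real.exp_pos _).le, ← Real.exp_add]
  congr 2
  ring

/-! ### The pointwise bound for the geometric mean -/

namespace QuasiNorm

variable {N : ℕ} {G : HomogeneousGroup N}

/-- The probability measure `ε t^{-ε} |𝔹(0,|y|)|^{ε-1} dy` on the quasi-ball of volume `t`, with
respect to which `geomMean` is a geometric mean. -/
noncomputable def meanMeasure (ν : QuasiNorm G) (ε t : ℝ) : Measure (EuclideanSpace ℝ (Fin N)) :=
  (volume.restrict (ν.ballVol ⁻¹' Set.Iio t)).withDensity fun y =>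
    ENNReal.ofReal (ε * t ^ (-ε) * ν.ballVol y ^ (ε - 1))

variable {ε t : ℝ}

theorem measurable_meanDensity (hN : 0 < N) (ν : QuasiNorm G) :
    Measurable fun y => ENNReal.ofReal (ε * t ^ (-ε) * ν.ballVol y ^ (ε - 1)) := by
  have := ν.measurable_ballVol hN
  fun_prop

theorem lintegral_meanMeasure (hN : 0 < N) (ν : QuasiNorm G) (hε : 0 < ε) (ht : 0 < t)
    {g : EuclideanSpace ℝ (Fin N) → ℝ≥0∞} (hg : Measurable g) :
    ∫⁻ y, g y ∂ν.meanMeasure ε t = ENNReal.ofReal (ε * t ^ (-ε)) *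
      ∫⁻ y in ν.ballVol ⁻¹' Set.Iio t, ENNReal.ofReal (ν.ballVol y ^ (ε - 1)) * g y := by
  have hV := ν.measurable_ballVol hN
  rw [meanMeasure, lintegral_withDensity_eq_lintegral_mul _ (ν.measurable_meanDensity hN) hg,
    ← lintegral_const_mul _ (by fun_prop)]
  refine lintegral_congr fun y => ?_
  rw [Pi.mul_apply, ENNReal.ofReal_mul (by positivity), mul_assoc]

theorem isProbabilityMeasure_meanMeasure (hN : 0 < N) (ν : QuasiNorm G) (hε : 0 < ε)
    (ht : 0 < t) : IsProbabilityMeasure (ν.meanMeasure ε t) := by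
  refine ⟨?_⟩
  rw [← lintegral_one, ν.lintegral_meanMeasure hN hε ht measurable_const]
  simp_rw [mul_one]
  rw [ν.lintegral_ballVol_rpow_lt hN hε ht, ← ENNReal.ofReal_mul (by positivity),
    Real.rpow_neg ht.le]
  have := Real.rpow_pos_of_pos ht ε
  rw [show ε * (t ^ ε)⁻¹ * (t ^ ε / ε) = 1 by field_simp, ENNReal.ofReal_one]

theorem integrable_log_meanMeasure (hN : 0 < N) (ν : QuasiNorm G) (hε : 0 < ε) (ht : 0 < t) :
    Integrable (fun y => Real.log (ν.ballVol y)) (ν.meanMeasure ε t) ∧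
      ∫ y, Real.log (ν.ballVol y) ∂ν.meanMeasure ε t = Real.log t - 1 / ε := by
  have hdens : ∀ y, (ENNReal.ofReal (ε * t ^ (-ε) * ν.ballVol y ^ (ε - 1))).toReal •
      Real.log (ν.ballVol y) =
        ε * t ^ (-ε) * (ν.ballVol y ^ (ε - 1) * Real.log (ν.ballVol y)) := fun y => by
    rw [ENNReal.toReal_ofReal (mul_nonneg (by positivity)
      (Real.rpow_nonneg (ν.ballVol_nonneg y) _)), smul_eq_mul, mul_assoc]
  constructor
  · rw [meanMeasure, integrable_withDensity_iff_integrable_smul' (ν.measurable_meanDensity hN)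
      (Filter.Eventually.of_forall fun _ => ENNReal.ofReal_lt_top)]
    simp_rw [hdens]
    exact (ν.integrableOn_ballVol_rpow_mul_log hN hε ht).const_mul _
  · rw [meanMeasure, integral_withDensity_eq_integral_toReal_smul (ν.measurable_meanDensity hN)
      (Filter.Eventually.of_forall fun _ => ENNReal.ofReal_lt_top)]
    simp_rw [hdens]
    rw [integral_const_mul, ν.integral_ballVol_rpow_mul_log hN hε ht, Real.rpow_neg ht.le]
    have := Real.rpow_pos_of_pos ht ε
    field_simp

theorem geomMean_eq (hN : 0 < N) (ν : QuasiNorm G) (hε : 0 < ε)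
    {f : EuclideanSpace ℝ (Fin N) → ℝ} (hf : Measurable f) {x : EuclideanSpace ℝ (Fin N)}
    (hx : 0 < ν.ballVol x) :
    ν.geomMean ε f x = EReal.exp
      (((∫⁻ y, ENNReal.ofReal (Real.log (f y)) ∂ν.meanMeasure ε (ν.ballVol x) : ℝ≥0∞) : EReal) -
        ((∫⁻ y, ENNReal.ofReal (-Real.log (f y)) ∂ν.meanMeasure ε (ν.ballVol x) : ℝ≥0∞) :
          EReal)) := by
  have hc : 0 ≤ ε * ν.ballVol x ^ (-ε) := by positivity
  rw [ν.lintegral_meanMeasure hN hε hx (by fun_prop),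
    ν.lintegral_meanMeasure hN hε hx (by fun_prop), geomMean, extIntegralOn, ν.ball_toFun_eq hN,
    EReal.coe_ennreal_mul, EReal.coe_ennreal_mul, EReal.coe_ennreal_ofReal, max_eq_left hc,
    EReal.mul_sub_of_nonneg_of_ne_top (EReal.coe_nonneg.2 hc) (EReal.coe_ne_top _)]
  simp_rw [← mul_neg, ENNReal.ofReal_mul (Real.rpow_nonneg (ν.ballVol_nonneg _) _)]
  rfl

/-- Jensen's inequality applied to `log (f ^ p V ^ (b + 1))`: the extra factor `V ^ (b + 1)`, whose
geometric mean is `(e^{-1/ε} V) ^ (b + 1)`, turns the weight `V ^ b` of the right-hand side into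
the kernel `V(y) ^ ε / V(x) ^ (ε + b + 1)`. -/
theorem geomMean_rpow_le (hN : 0 < N) (ν : QuasiNorm G) (hε : 0 < ε) {p b : ℝ} (hp : 0 < p)
    {f : EuclideanSpace ℝ (Fin N) → ℝ} (hf : Measurable f) (hf0 : ∀ y, 0 < f y)
    {x : EuclideanSpace ℝ (Fin N)} (hx : 0 < ν.ballVol x) :
    ν.geomMean ε f x ^ p ≤
      ENNReal.ofReal (Real.exp ((b + 1) / ε) * ε * ν.ballVol x ^ (-(b + 1) - ε)) *
        ∫⁻ y in ν.ballVol ⁻¹' Set.Iio (ν.ballVol x), ENNReal.ofReal (ν.ballVol y ^ ε) *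
          (ENNReal.ofReal (f y) ^ p * ENNReal.ofReal (ν.ballVol y ^ b)) := by
  have hV := ν.measurable_ballVol hN
  obtain ⟨hi, hival⟩ := ν.integrable_log_meanMeasure hN hε hx
  have := ν.isProbabilityMeasure_meanMeasure hN hε hx
  rw [ν.geomMean_eq hN hε hf hx]
  refine (exp_extIntegral_rpow_le (φ := fun y => Real.log (f y)) (by fun_prop)
    (hi.const_mul (b + 1)) hp).trans (le_of_eq ?_)
  rw [integral_const_mul, hival, ν.lintegral_meanMeasure hN hε hx (by fun_prop), ← mul_assoc,
    ← ENNReal.ofReal_mul (Real.exp_pos _).le]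
  congr 1
  · congr 1
    rw [show -(b + 1) - ε = -(b + 1) + -ε by ring, Real.rpow_add hx,
      Real.rpow_def_of_pos hx (-(b + 1)),
      show -((b + 1) * (Real.log (ν.ballVol x) - 1 / ε)) =
        (b + 1) / ε + Real.log (ν.ballVol x) * -(b + 1) by ring, Real.exp_add]
    ring
  · refine lintegral_congr_ae (ae_restrict_of_ae ?_)
    filter_upwards [ν.ae_ballVol_pos hN] with y hy
    rw [ENNReal.ofReal_rpow_of_pos (hf0 y), Real.exp_add, mul_comm p, ← Real.rpow_def_of_pos
      (hf0 y), mul_comm (b + 1), ← Real.rpow_def_of_pos hy,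
      ← ENNReal.ofReal_mul (by have := hf0 y; positivity),
      ← ENNReal.ofReal_mul (by have := hf0 y; positivity),
      ← ENNReal.ofReal_mul (by have := hf0 y; positivity)]
    congr 1
    have h1 : ν.ballVol y ^ (ε - 1) * ν.ballVol y ^ (b + 1) =
        ν.ballVol y ^ ε * ν.ballVol y ^ b := by
      rw [← Real.rpow_add hy, ← Real.rpow_add hy]
      congr 1
      ring
    linear_combination f y ^ p * h1

end QuasiNorm

/-! ### The upper bound -/

/-- Hölder's inequality in the form of the power mean inequality for the measure `W dμ`. -/
theorem lintegral_mul_rpow_le {X : Type*} [MeasurableSpace X] {μ : Measure X} {h W : X → ℝ≥0∞}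
    (hh : Measurable h) (hW : Measurable W) {r : ℝ} (hr : 1 ≤ r) :
    (∫⁻ y, h y * W y ∂μ) ^ r ≤ (∫⁻ y, W y ∂μ) ^ (r - 1) * ∫⁻ y, h y ^ r * W y ∂μ := by
  have hr0 : 0 < r := by linarith
  have key := eLpNorm'_le_eLpNorm'_mul_rpow_measure_univ (μ := μ.withDensity W) (f := h)
    one_pos hr hh.aestronglyMeasurable
  simp only [eLpNorm', enorm_eq_self, ENNReal.rpow_one, div_one,
    withDensity_apply _ MeasurableSet.univ, Measure.restrict_univ] at key
  rw [lintegral_withDensity_eq_lintegral_mul _ hW hh,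
    lintegral_withDensity_eq_lintegral_mul _ hW (by fun_prop)] at key
  have h2 := ENNReal.rpow_le_rpow key hr0.le
  rw [ENNReal.mul_rpow_of_nonneg _ _ hr0.le, ← ENNReal.rpow_mul, ← ENNReal.rpow_mul,
    one_div_mul_cancel hr0.ne', ENNReal.rpow_one,
    show (1 - 1 / r) * r = r - 1 by field_simp] at h2
  simp only [Pi.mul_apply] at h2
  simp_rw [mul_comm _ (W _)]
  rwa [mul_comm (_ ^ (r - 1))]

namespace QuasiNorm

variable {N : ℕ} {G : HomogeneousGroup N}

/-- By Tonelli the kernel `V(x) ^ (-1-β) V(y) ^ β` on `V(y) < V(x)` has constant mass `1 / β` in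
the variable `x`. -/
theorem lintegral_kernel (hN : 0 < N) (ν : QuasiNorm G) {β : ℝ} (hβ : 0 < β)
    {W : EuclideanSpace ℝ (Fin N) → ℝ≥0∞} (hW : Measurable W) :
    ∫⁻ x, ENNReal.ofReal (ν.ballVol x ^ (-1 - β)) *
        ∫⁻ y in ν.ballVol ⁻¹' Set.Iio (ν.ballVol x), ENNReal.ofReal (ν.ballVol y ^ β) * W y =
      ENNReal.ofReal (1 / β) * ∫⁻ y, W y := by
  have hV := ν.measurable_ballVol hN
  set H : EuclideanSpace ℝ (Fin N) → ℝ≥0∞ := fun y => ENNReal.ofReal (ν.ballVol y ^ β) * W y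
    with hH
  have hHm : Measurable H := by fun_prop
  set A : EuclideanSpace ℝ (Fin N) → ℝ≥0∞ := fun x => ENNReal.ofReal (ν.ballVol x ^ (-1 - β))
    with hA
  have hAm : Measurable A := by fun_prop
  have hset : MeasurableSet {z : EuclideanSpace ℝ (Fin N) × EuclideanSpace ℝ (Fin N) |
      ν.ballVol z.2 < ν.ballVol z.1} := measurableSet_lt (by fun_prop) (by fun_prop)
  set K : EuclideanSpace ℝ (Fin N) → EuclideanSpace ℝ (Fin N) → ℝ≥0∞ := fun x y =>
    Set.indicator {z : EuclideanSpace ℝ (Fin N) × EuclideanSpace ℝ (Fin N) |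
      ν.ballVol z.2 < ν.ballVol z.1} (fun z => A z.1 * H z.2) (x, y) with hK
  have hKm : AEMeasurable (Function.uncurry K) (volume.prod volume) := by
    have : Measurable (Function.uncurry K) :=
      Measurable.indicator (by fun_prop) hset
    exact this.aemeasurable
  have hleft : ∀ x, A x * ∫⁻ y in ν.ballVol ⁻¹' Set.Iio (ν.ballVol x), H y = ∫⁻ y, K x y :=
    fun x => by
      rw [← lintegral_const_mul _ hHm, ← lintegral_indicator (hV measurableSet_Iio)]
      rfl
  have hright : ∀ y, ∫⁻ x, K x y =
      H y * ∫⁻ x in ν.ballVol ⁻¹' Set.Ioi (ν.ballVol y), A x := fun y => by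
    rw [← lintegral_const_mul _ hAm, ← lintegral_indicator (hV measurableSet_Ioi)]
    simp_rw [mul_comm (H y)]
    rfl
  refine (lintegral_congr hleft).trans ?_
  rw [lintegral_lintegral_swap hKm, ← lintegral_const_mul _ hW]
  refine lintegral_congr_ae ?_
  filter_upwards [ν.ae_ballVol_pos hN] with y hy
  rw [hright, hA, ν.lintegral_ballVol_rpow_gt hN hβ hy, hH, mul_right_comm,
    ← ENNReal.ofReal_mul (by positivity), Real.rpow_neg hy.le]
  have := Real.rpow_pos_of_pos hy β
  congr 2
  field_simp

theorem levinCochranLee_upper (hN : 0 < N) (ν : QuasiNorm G) {p q a b ε : ℝ} (hp : 0 < p)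
    (hpq : p ≤ q) (hε : 0 < ε) (hab : p * (a + 1) - q * (b + 1) = 0) :
    ν.LevinCochranLee p q a b ε
      ((p / q) ^ (1 / q) * ε ^ (1 / p - 1 / q) * Real.exp ((b + 1) / (ε * p))) := by
  intro f hf hf0
  have hq : 0 < q := hp.trans_le hpq
  have hV := ν.measurable_ballVol hN
  set r := q / p with hr
  have hr1 : 1 ≤ r := (one_le_div hp).2 hpq
  have hr0 : 0 < r := by positivity
  have hpr : p * r = q := mul_div_cancel₀ q hp.ne'
  have har : a + 1 = r * (b + 1) := by
    rw [hr]; field_simp; linarith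
  set W : EuclideanSpace ℝ (Fin N) → ℝ≥0∞ := fun y =>
    ENNReal.ofReal (f y) ^ p * ENNReal.ofReal (ν.ballVol y ^ b) with hW
  have hWm : Measurable W := by fun_prop
  set M := ∫⁻ y, W y with hM
  set c := Real.exp ((b + 1) / ε) * ε with hc
  have hc0 : 0 < c := by positivity
  have hpoint : ∀ᵐ x, ν.geomMean ε f x ^ q * ENNReal.ofReal (ν.ballVol x ^ a) ≤
      ENNReal.ofReal (c ^ r) * M ^ (r - 1) * (ENNReal.ofReal (ν.ballVol x ^ (-1 - ε * r)) *
        ∫⁻ y in ν.ballVol ⁻¹' Set.Iio (ν.ballVol x),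
          ENNReal.ofReal (ν.ballVol y ^ (ε * r)) * W y) := by
    filter_upwards [ν.ae_ballVol_pos hN] with x hx
    set S := ν.ballVol ⁻¹' Set.Iio (ν.ballVol x)
    have h1 : (∫⁻ y in S, ENNReal.ofReal (ν.ballVol y ^ ε) * W y) ^ r ≤
        M ^ (r - 1) * ∫⁻ y in S, ENNReal.ofReal (ν.ballVol y ^ (ε * r)) * W y := by
      refine (lintegral_mul_rpow_le (by fun_prop) hWm hr1).trans ?_
      simp_rw [ENNReal.ofReal_rpow_of_nonneg (Real.rpow_nonneg (ν.ballVol_nonneg _) ε) hr0.le,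
        ← Real.rpow_mul (ν.ballVol_nonneg _)]
      gcongr
      exact setLIntegral_le_lintegral _ _
    have h2 := ENNReal.rpow_le_rpow (ν.geomMean_rpow_le hN hε (b := b) hp hf hf0 hx) hr0.le
    rw [← ENNReal.rpow_mul, hpr, ENNReal.mul_rpow_of_nonneg _ _ hr0.le,
      ENNReal.ofReal_rpow_of_pos (by positivity), Real.mul_rpow hc0.le (by positivity),
      ← Real.rpow_mul hx.le, ENNReal.ofReal_mul (by positivity)] at h2
    have h3 : ENNReal.ofReal (ν.ballVol x ^ ((-(b + 1) - ε) * r)) *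
        ENNReal.ofReal (ν.ballVol x ^ a) = ENNReal.ofReal (ν.ballVol x ^ (-1 - ε * r)) := by
      rw [← ENNReal.ofReal_mul (by positivity), ← Real.rpow_add hx]
      congr 2
      linarith
    calc ν.geomMean ε f x ^ q * ENNReal.ofReal (ν.ballVol x ^ a)
        ≤ ENNReal.ofReal (c ^ r) * ENNReal.ofReal (ν.ballVol x ^ ((-(b + 1) - ε) * r)) *
          (∫⁻ y in S, ENNReal.ofReal (ν.ballVol y ^ ε) * W y) ^ r *
          ENNReal.ofReal (ν.ballVol x ^ a) := by gcongr
      _ = ENNReal.ofReal (c ^ r) * ENNReal.ofReal (ν.ballVol x ^ (-1 - ε * r)) *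
          (∫⁻ y in S, ENNReal.ofReal (ν.ballVol y ^ ε) * W y) ^ r := by rw [← h3]; ring
      _ ≤ ENNReal.ofReal (c ^ r) * ENNReal.ofReal (ν.ballVol x ^ (-1 - ε * r)) *
          (M ^ (r - 1) * ∫⁻ y in S, ENNReal.ofReal (ν.ballVol y ^ (ε * r)) * W y) := by gcongr
      _ = _ := by ring
  have hεr : 0 < ε * r := by positivity
  have htotal : ∫⁻ x, ν.geomMean ε f x ^ q * ENNReal.ofReal (ν.ballVol x ^ a) ≤
      ENNReal.ofReal (c ^ r * (1 / (ε * r))) * M ^ r := by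
    refine (lintegral_mono_ae hpoint).trans ?_
    have hmeas : Measurable fun x => ∫⁻ y in ν.ballVol ⁻¹' Set.Iio (ν.ballVol x),
        ENNReal.ofReal (ν.ballVol y ^ (ε * r)) * W y := by
      have hmono : Monotone fun t : ℝ => ∫⁻ y in ν.ballVol ⁻¹' Set.Iio t,
          ENNReal.ofReal (ν.ballVol y ^ (ε * r)) * W y := fun s t hst =>
        lintegral_mono_set (Set.preimage_mono (Set.Iio_subset_Iio hst))
      exact hmono.measurable.comp hV
    rw [lintegral_const_mul _ (by fun_prop), ν.lintegral_kernel hN hεr hWm, ← hM,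
      ENNReal.ofReal_mul (by positivity)]
    have h4 : M ^ (r - 1) * M = M ^ r := by
      nth_rewrite 2 [← ENNReal.rpow_one M]
      rw [← ENNReal.rpow_add_of_nonneg _ _ (by linarith) zero_le_one, sub_add_cancel]
    rw [← h4]
    exact le_of_eq (by ring)
  refine (ENNReal.rpow_le_rpow htotal (by positivity)).trans (le_of_eq ?_)
  rw [ENNReal.mul_rpow_of_nonneg _ _ (by positivity), ← ENNReal.rpow_mul,
    ENNReal.ofReal_rpow_of_pos (by positivity)]
  have h5 : r * (1 / q) = 1 / p := by rw [hr]; field_simp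
  rw [h5]
  congr 2
  rw [Real.mul_rpow (by positivity) (by positivity), ← Real.rpow_mul hc0.le, h5, hc,
    Real.mul_rpow (Real.exp_pos _).le hε.le, ← Real.exp_mul,
    show 1 / (ε * r) = p / q * ε⁻¹ by rw [hr]; field_simp,
    Real.mul_rpow (by positivity) (by positivity), Real.inv_rpow hε.le, Real.rpow_sub hε,
    show (b + 1) / ε * (1 / p) = (b + 1) / (ε * p) by field_simp]
  ring

end QuasiNorm

/-! ### Test functions -/

namespace QuasiNorm

variable {N : ℕ} {G : HomogeneousGroup N}

/-- The test function equal to `V ^ k` on the quasi-ball of volume `T`, where `V` is the volume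
function, with the tail `(η V ^ (-2 - b)) ^ (1 / p)` outside: its contribution `η / T` to the
right-hand side can be made arbitrarily small. The value at the origin is `1`, so that the
function is positive. -/
noncomputable def testFun (ν : QuasiNorm G) (p b k T η : ℝ) (x : EuclideanSpace ℝ (Fin N)) : ℝ :=
  if ν.ballVol x ≤ 0 then 1
  else if ν.ballVol x < T then ν.ballVol x ^ k
  else (η * ν.ballVol x ^ (-2 - b)) ^ (1 / p)

variable {p q a b ε k T η : ℝ}

theorem measurable_testFun (hN : 0 < N) (ν : QuasiNorm G) : Measurable (ν.testFun p b k T η) := by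
  have hV := ν.measurable_ballVol hN
  exact Measurable.ite (measurableSet_le hV measurable_const) measurable_const
    (Measurable.ite (measurableSet_lt hV measurable_const) (by fun_prop) (by fun_prop))

theorem testFun_pos (ν : QuasiNorm G) (hη : 0 < η) (x : EuclideanSpace ℝ (Fin N)) :
    0 < ν.testFun p b k T η x := by
  unfold testFun
  split_ifs with h1 h2
  · exact one_pos
  · exact Real.rpow_pos_of_pos (not_le.1 h1) _
  · have := not_le.1 h1
    positivity

theorem log_testFun (ν : QuasiNorm G) {x : EuclideanSpace ℝ (Fin N)} (hx : ν.ballVol x < T) :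
    Real.log (ν.testFun p b k T η x) = k * Real.log (ν.ballVol x) := by
  unfold testFun
  split_ifs with h1
  · rw [le_antisymm h1 (ν.ballVol_nonneg x), Real.log_one, Real.log_zero, mul_zero]
  · exact Real.log_rpow (not_le.1 h1) k

theorem geomMean_testFun (hN : 0 < N) (ν : QuasiNorm G) (hε : 0 < ε)
    {x : EuclideanSpace ℝ (Fin N)} (hx : 0 < ν.ballVol x) (hxT : ν.ballVol x < T) :
    ν.geomMean ε (ν.testFun p b k T η) x =
      ENNReal.ofReal (Real.exp (-(k / ε)) * ν.ballVol x ^ k) := by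
  obtain ⟨hi, hival⟩ := ν.integrable_log_meanMeasure hN hε hx
  have hV := ν.measurable_ballVol hN
  have hae : ∀ᵐ y ∂ν.meanMeasure ε (ν.ballVol x),
      Real.log (ν.testFun p b k T η y) = k * Real.log (ν.ballVol y) := by
    refine (withDensity_absolutelyContinuous _ _).ae_le ?_
    filter_upwards [ae_restrict_mem (hV measurableSet_Iio)] with y hy
    exact ν.log_testFun ((show ν.ballVol y < ν.ballVol x from hy).trans hxT)
  rw [ν.geomMean_eq hN hε (ν.measurable_testFun hN) hx,
    lintegral_congr_ae (hae.mono fun y hy => congrArg ENNReal.ofReal hy),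
    lintegral_congr_ae (hae.mono fun y hy => congrArg (fun u => ENNReal.ofReal (-u)) hy),
    lintegral_sub_lintegral_eq_integral (hi.const_mul k), integral_const_mul, hival,
    EReal.exp_coe, Real.rpow_def_of_pos hx, ← Real.exp_add]
  congr 2
  ring

theorem lintegral_testFun_le (hN : 0 < N) (ν : QuasiNorm G) (hp : 0 < p) (hT : 0 < T)
    (hη : 0 < η) (hB : 0 < k * p + b + 1) :
    ∫⁻ x, ENNReal.ofReal (ν.testFun p b k T η x) ^ p * ENNReal.ofReal (ν.ballVol x ^ b) ≤
      ENNReal.ofReal (T ^ (k * p + b + 1) / (k * p + b + 1) + η / T) := by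
  have hV := ν.measurable_ballVol hN
  have hTm : MeasurableSet (ν.ballVol ⁻¹' Set.Iio T) := hV measurableSet_Iio
  rw [← lintegral_add_compl _ hTm, ENNReal.ofReal_add (by positivity) (by positivity)]
  refine add_le_add (le_of_eq ?_) ?_
  · rw [← ν.lintegral_ballVol_rpow_lt hN hB hT]
    refine lintegral_congr_ae ?_
    filter_upwards [ae_restrict_of_ae (ν.ae_ballVol_pos hN), ae_restrict_mem hTm] with x hx hxT
    rw [testFun, if_neg (not_le.2 hx), if_pos (show ν.ballVol x < T from hxT),
      ENNReal.ofReal_rpow_of_pos (by positivity), ← ENNReal.ofReal_mul (by positivity),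
      ← Real.rpow_mul hx.le, ← Real.rpow_add hx]
    congr 2
    ring
  · have hcompl : (ν.ballVol ⁻¹' Set.Iio T)ᶜ = ν.ballVol ⁻¹' Set.Ici T := by
      ext x
      simp
    have hae : (ν.ballVol ⁻¹' Set.Ici T : Set (EuclideanSpace ℝ (Fin N))) =ᵐ[volume]
        (ν.ballVol ⁻¹' Set.Ioi T : Set (EuclideanSpace ℝ (Fin N))) := by
      have h : volume (ν.ballVol ⁻¹' {T}) = 0 := by
        rw [← Measure.map_apply hV (measurableSet_singleton T), ν.map_ballVol hN,
          Measure.restrict_apply (measurableSet_singleton T)]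
        exact measure_mono_null Set.inter_subset_left (by simp)
      rw [← Set.Ioi_insert, ← Set.singleton_union, Set.preimage_union]
      exact union_ae_eq_right_of_ae_eq_empty (ae_eq_empty.2 h)
    have h1 := ν.lintegral_ballVol_rpow_gt hN one_pos hT
    rw [hcompl, setLIntegral_congr hae, div_eq_mul_inv, ENNReal.ofReal_mul hη.le, ← Real.rpow_neg_one T,
      ← div_one (T ^ (-1 : ℝ)), ← h1, ← lintegral_const_mul _ (by fun_prop)]
    refine le_of_eq (lintegral_congr_ae ?_)
    filter_upwards [ae_restrict_mem (hV measurableSet_Ioi)] with x hxT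
    have hxT' : T < ν.ballVol x := hxT
    have hx : 0 < ν.ballVol x := hT.trans hxT'
    rw [testFun, if_neg (not_le.2 hx), if_neg (not_lt.2 hxT'.le),
      ENNReal.ofReal_rpow_of_pos (by positivity), ← Real.rpow_mul (by positivity),
      one_div_mul_cancel hp.ne', Real.rpow_one, ← ENNReal.ofReal_mul (by positivity),
      ← ENNReal.ofReal_mul hη.le, mul_assoc, ← Real.rpow_add hx]
    congr 3
    ring

theorem le_lintegral_geomMean_testFun (hN : 0 < N) (ν : QuasiNorm G) (hε : 0 < ε) (hT : 0 < T)
    (hA : 0 < k * q + a + 1) :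
    ENNReal.ofReal (Real.exp (-(k / ε)) ^ q * (T ^ (k * q + a + 1) / (k * q + a + 1))) ≤
      ∫⁻ x, ν.geomMean ε (ν.testFun p b k T η) x ^ q * ENNReal.ofReal (ν.ballVol x ^ a) := by
  have hV := ν.measurable_ballVol hN
  have hTm : MeasurableSet (ν.ballVol ⁻¹' Set.Iio T) := hV measurableSet_Iio
  refine le_trans (le_of_eq ?_) (setLIntegral_le_lintegral (ν.ballVol ⁻¹' Set.Iio T) _)
  rw [ENNReal.ofReal_mul (by positivity), ← ν.lintegral_ballVol_rpow_lt hN hA hT,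
    ← lintegral_const_mul _ (by fun_prop)]
  refine lintegral_congr_ae ?_
  filter_upwards [ae_restrict_of_ae (ν.ae_ballVol_pos hN), ae_restrict_mem hTm] with x hx hxT
  rw [ν.geomMean_testFun hN hε hx hxT, ENNReal.ofReal_rpow_of_pos (by positivity),
    Real.mul_rpow (Real.exp_pos _).le (by positivity), ENNReal.ofReal_mul (by positivity),
    mul_assoc, ← ENNReal.ofReal_mul (by positivity : 0 ≤ (ν.ballVol x ^ k) ^ q),
    ← Real.rpow_mul hx.le, ← Real.rpow_add hx]
  congr 3
  ring

/-- The inequality for the test functions, in the limit `η → 0` of vanishing tails. -/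
theorem LevinCochranLee.power_test (hN : 0 < N) {ν : QuasiNorm G} (hp : 0 < p) (hq : 0 < q)
    (hε : 0 < ε) {C : ℝ} (hC : 0 < C) (h : ν.LevinCochranLee p q a b ε C) (hT : 0 < T)
    (hA : 0 < k * q + a + 1) (hB : 0 < k * p + b + 1) :
    Real.exp (-(k / ε)) * (T ^ (k * q + a + 1) / (k * q + a + 1)) ^ (1 / q) ≤
      C * (T ^ (k * p + b + 1) / (k * p + b + 1)) ^ (1 / p) := by
  set A := k * q + a + 1
  set B := k * p + b + 1
  have hη : ∀ η : ℝ, 0 < η → Real.exp (-(k / ε)) * (T ^ A / A) ^ (1 / q) ≤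
      C * (T ^ B / B + η / T) ^ (1 / p) := fun η hη => by
    have h1 := (ENNReal.rpow_le_rpow (ν.le_lintegral_geomMean_testFun hN hε (p := p) (b := b)
      (η := η) hT hA) (by positivity : 0 ≤ 1 / q)).trans
      ((h _ (ν.measurable_testFun hN) (ν.testFun_pos hη)).trans
        (mul_le_mul_right (ENNReal.rpow_le_rpow (ν.lintegral_testFun_le hN hp hT hη hB)
          (by positivity : 0 ≤ 1 / p)) _))
    rw [ENNReal.ofReal_rpow_of_pos (by positivity), ENNReal.ofReal_rpow_of_pos (by positivity),
      ← ENNReal.ofReal_mul hC.le, ENNReal.ofReal_le_ofReal_iff (by positivity),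
      Real.mul_rpow (by positivity) (by positivity), ← Real.rpow_mul (Real.exp_pos _).le,
      mul_one_div_cancel hq.ne', Real.rpow_one] at h1
    exact h1
  have hlim : Filter.Tendsto (fun η : ℝ => C * (T ^ B / B + η / T) ^ (1 / p))
      (nhdsWithin 0 (Set.Ioi 0)) (nhds (C * (T ^ B / B + 0 / T) ^ (1 / p))) := by
    have hcont : Continuous fun η : ℝ => C * (T ^ B / B + η / T) ^ (1 / p) :=
      continuous_const.mul (Continuous.rpow_const (by fun_prop)
        fun _ => Or.inr (by positivity))
    exact (hcont.tendsto 0).mono_left nhdsWithin_le_nhds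
  rw [zero_div, add_zero] at hlim
  exact ge_of_tendsto hlim (by filter_upwards [self_mem_nhdsWithin] with η h using hη η h)

/-! ### Necessity of the balance condition and the lower bound -/

/-- A power of `T` that is bounded as `T → 0` and as `T → ∞` has exponent zero. -/
theorem eq_zero_of_rpow_le {γ K : ℝ} (h : ∀ T : ℝ, 0 < T → T ^ γ ≤ K) : γ = 0 := by
  by_contra hγ
  have hK : 1 ≤ K := by simpa using h 1 one_pos
  have h1 := h ((K + 1) ^ (1 / γ)) (by positivity)
  rw [← Real.rpow_mul (by positivity), one_div_mul_cancel hγ, Real.rpow_one] at h1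
  linarith

theorem LevinCochranLee.balance (hN : 0 < N) {ν : QuasiNorm G} (hp : 0 < p) (hq : 0 < q)
    (hε : 0 < ε) {C : ℝ} (hC : 0 < C) (h : ν.LevinCochranLee p q a b ε C) :
    p * (a + 1) - q * (b + 1) = 0 := by
  -- an exponent large enough for both sides to be finite and positive
  obtain ⟨k, hA, hB⟩ : ∃ k : ℝ, 0 < k * q + a + 1 ∧ 0 < k * p + b + 1 := by
    refine ⟨(|a + 1| + 1) / q + (|b + 1| + 1) / p, ?_, ?_⟩
    · have h1 : 0 < (|b + 1| + 1) / p * q := by positivity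
      have h2 := neg_abs_le (a + 1)
      rw [add_mul, div_mul_cancel₀ _ hq.ne']
      linarith
    · have h1 : 0 < (|a + 1| + 1) / q * p := by positivity
      have h2 := neg_abs_le (b + 1)
      rw [add_mul, div_mul_cancel₀ _ hp.ne']
      linarith
  set A := k * q + a + 1 with hAdef
  set B := k * p + b + 1 with hBdef
  have hγ : A / q - B / p = 0 := by
    refine eq_zero_of_rpow_le (K := C * (1 / B) ^ (1 / p) /
      (Real.exp (-(k / ε)) * (1 / A) ^ (1 / q))) fun T hT => ?_
    have h1 := h.power_test hN hp hq hε hC hT hA hB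
    rw [← hAdef, ← hBdef, div_eq_mul_one_div (T ^ A), div_eq_mul_one_div (T ^ B),
      Real.mul_rpow (by positivity) (by positivity), Real.mul_rpow (by positivity) (by positivity),
      ← Real.rpow_mul hT.le, ← Real.rpow_mul hT.le, mul_one_div, mul_one_div] at h1
    rw [Real.rpow_sub hT, div_le_div_iff₀ (by positivity) (by positivity)]
    linarith
  have h2 : A / q - B / p = (p * (a + 1) - q * (b + 1)) / (p * q) := by
    rw [hAdef, hBdef]
    field_simp
    ring
  rw [h2, div_eq_zero_iff] at hγ
  exact hγ.resolve_right (by positivity)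

theorem LevinCochranLee.lower_bound (hN : 0 < N) {ν : QuasiNorm G} (hp : 0 < p) (hq : 0 < q)
    (hε : 0 < ε) (hab : p * (a + 1) - q * (b + 1) = 0) {C : ℝ} (hC : 0 < C)
    (h : ν.LevinCochranLee p q a b ε C) :
    (p / q) ^ (1 / q) * ε ^ (1 / p - 1 / q) * Real.exp ((b + 1) / (ε * p) - 1 / p) ≤ C := by
  -- the exponent for which the density `f ^ p V ^ b` equals `V ^ (ε - 1)`
  set k := (ε - 1 - b) / p with hk
  have hB : k * p + b + 1 = ε := by
    rw [hk]
    field_simp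
    ring
  have hA : k * q + a + 1 = ε * (q / p) := by
    rw [hk]
    field_simp
    linarith
  have h1 := h.power_test (T := 1) (k := k) hN hp hq hε hC one_pos (by rw [hA]; positivity)
    (by rw [hB]; exact hε)
  rw [hA, hB, Real.one_rpow, Real.one_rpow,
    show 1 / (ε * (q / p)) = p / q * ε⁻¹ by field_simp,
    Real.mul_rpow (by positivity) (by positivity), one_div ε, Real.inv_rpow hε.le,
    Real.inv_rpow hε.le, ← div_eq_mul_inv C, le_div_iff₀ (by positivity)] at h1
  refine le_trans (le_of_eq ?_) h1
  rw [Real.rpow_sub hε, show -(k / ε) = (b + 1) / (ε * p) - 1 / p by rw [hk]; field_simp; ring]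
  ring

/-! ### The least constant -/

/-- The admissible constants form a closed set in `(0, ∞)`, so a positive lower bound makes their
infimum admissible. -/
theorem exists_isLeast_levinCochranLee (ν : QuasiNorm G) {L K : ℝ} (hL : 0 < L)
    (hlow : ∀ C, 0 < C → ν.LevinCochranLee p q a b ε C → L ≤ C)
    (hK : 0 < K ∧ ν.LevinCochranLee p q a b ε K) :
    ∃ C, IsLeast {C' : ℝ | 0 < C' ∧ ν.LevinCochranLee p q a b ε C'} C := by
  set S := {C' : ℝ | 0 < C' ∧ ν.LevinCochranLee p q a b ε C'} with hS
  have hne : S.Nonempty := ⟨K, hK⟩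
  have hbdd : BddBelow S := ⟨L, fun C hC => hlow C hC.1 hC.2⟩
  have hpos : 0 < sInf S := hL.trans_le (le_csInf hne fun C hC => hlow C hC.1 hC.2)
  refine ⟨sInf S, ⟨hpos, fun f hf hf0 => ?_⟩, fun C hC => csInf_le hbdd hC⟩
  set R := (∫⁻ x, ENNReal.ofReal (f x) ^ p * ENNReal.ofReal (ν.ballVol x ^ b)) ^ (1 / p)
  by_cases hR : R = ⊤
  · rw [hR, ENNReal.mul_top (by simpa using hpos)]
    exact le_top
  have hlim : Filter.Tendsto (fun C : ℝ => ENNReal.ofReal C * R)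
      (nhdsWithin (sInf S) (Set.Ioi (sInf S))) (nhds (ENNReal.ofReal (sInf S) * R)) :=
    (((ENNReal.continuous_mul_const hR).comp ENNReal.continuous_ofReal).tendsto _).mono_left
      nhdsWithin_le_nhds
  refine ge_of_tendsto hlim ?_
  filter_upwards [self_mem_nhdsWithin] with C hC
  obtain ⟨C', hC', hlt⟩ := exists_lt_of_csInf_lt hne hC
  exact (hC'.2 f hf hf0).trans (mul_le_mul_left (ENNReal.ofReal_le_ofReal hlt.le) R)

end QuasiNorm

theorem theorem3p2 {N : ℕ} (hN : 0 < N) (G : HomogeneousGroup N) (ν : QuasiNorm G)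
    (p q a b ε : ℝ) (hp : 0 < p) (hpq : p ≤ q) (hε : 0 < ε) :
    ((∃ C : ℝ, 0 < C ∧ ν.LevinCochranLee p q a b ε C) ↔ p * (a + 1) - q * (b + 1) = 0) ∧
    (p * (a + 1) - q * (b + 1) = 0 →
      ∃ C : ℝ, IsLeast {C' : ℝ | 0 < C' ∧ ν.LevinCochranLee p q a b ε C'} C ∧
        (p / q) ^ (1 / q) * ε ^ (1 / p - 1 / q) * Real.exp ((b + 1) / (ε * p) - 1 / p) ≤ C ∧
        C ≤ (p / q) ^ (1 / q) * ε ^ (1 / p - 1 / q) * Real.exp ((b + 1) / (ε * p))) := by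
  have hq : 0 < q := hp.trans_le hpq
  have hK : 0 < (p / q) ^ (1 / q) * ε ^ (1 / p - 1 / q) * Real.exp ((b + 1) / (ε * p)) := by
    positivity
  refine ⟨⟨fun ⟨C, hC, h⟩ => h.balance hN hp hq hε hC, fun hab =>
    ⟨_, hK, ν.levinCochranLee_upper hN hp hpq hε hab⟩⟩, fun hab => ?_⟩
  have hupper := ν.levinCochranLee_upper hN hp hpq hε hab
  obtain ⟨C, hC⟩ := ν.exists_isLeast_levinCochranLee (by positivity)
    (fun C hC h => h.lower_bound hN hp hq hε hab hC) ⟨hK, hupper⟩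
  exact ⟨C, hC, hC.1.2.lower_bound hN hp hq hε hab hC.1.1, hC.2 ⟨hK, hupper⟩⟩
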